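/- Consider four-dimensional theories (signature $(-,+,+,+)$, $G=c=1$) with action $$S=\int d^4x\sqrt{-g}\Big(\tfrac{1}{16\pi}R+\epsilon\,\Phi\,\mathcal F-\tfrac12\nabla_a\Phi\nabla^a\Phi\Big)+S_{\rm matter},$$ where $\mathcal F$ is a curvature scalar of $g$. The field equations are $\Box\Phi+\epsilon\mathcal F=0$ and $G_{ab}+16\pi\epsilon\,\mathcal C_{ab}=8\pi(T^\Phi_{ab}+T^{\rm matter}_{ab})$, where $\mathcal C_{ab}=\frac{1}{\sqrt{-g}}\frac{\delta}{\delta g^{ab}}\int\sqrt{-g}\,\Phi\mathcal F$ and $T^\Phi_{ab}=\nabla_a\Phi\nabla_b\Phi-\frac12 g_{ab}\nabla^c\Phi\nabla_c\Phi$. Let a static, spherically symmetric black hole be given near its event horizon $r=0$ in Gaussian null coordinates, $$ds^2=-D(r)\,dv^2+2\,dv\,dr+K(r)(d\theta^2+\sin^2\theta\,d\phi^2),\qquad |r|<\delta ,$$ with $D,K$ smooth, $D>0$ for $0<r<\delta$ (the exterior, where $\partial_v$ is timelike), $K>0$ for $0\le r<\delta$ (cross sections are spheres of finite positive Gaussian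 curvature $1/K$), and $D(r)=r^{1+p}D_0(r)$ for $0\le r<\delta$ with $p\ge 0$ real, $D_0$ smooth, $D_0(0)\ne0$. Let $\Phi=\Phi(r)$ be a scalar field that is regular at the horizon, that is, smooth on $|r|<\delta$. The surface gravity $\kappa$ is defined by $\xi^b\nabla_b\xi^a=\kappa\,\xi^a$ on the horizon, $\xi=\partial_v$ (so $\kappa=\Gamma^v_{vv}|_{r=0}$). Call the black hole non-extremal if $\kappa$ is nonzero and finite. Field equations are imposed for $0\le r<\delta$. Then: 1. (Arbitrary curvature scalar, arbitrary matter.) If $\epsilon\neq0$, the scalar equation holds and $\mathcal F|_{r=0}\ne0$, then $p=0$ and the black hole is non-extremal. 2. (Modified quadratic gravity.) Let $\mathcal F=\alpha_1R^2+\alpha_2R_{ab}R^{ab}+\alpha_3R_{abcd}R^{abcd}$. If both field equations hold without matter, then $p=0$ and the black hole is non-extremal, whether or not $\mathcal F$ vanishes at the horizon, and to whatever order. 3. ($\mathcal F(R)$ theories.) Let $\mathcal F=P(R)$ with a real polynomial $P$, or $\mathcal F=\alpha_1R+\alpha_2R_{ab}R^{ab}+\alpha_3R_{abcd}R^{abcd}$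 (put $P(R)=\alpha_1R$ then), with the coefficients independent of $\epsilon$. (a) Let $S\subseteq\mathbb R$ be a set of couplings with $0\in\overline S$, and for each $\epsilon\in S$ let $(D_\epsilon,K_\epsilon,\Phi_\epsilon)$, with exponent $p_\epsilon$ and coordinate range $|r|<\delta_\epsilon$, be a black hole with regular scalar field as above that solves both field equations with coupling $\epsilon$ without matter. Suppose the family is regular in the coupling at the horizon: the values and all $r$-derivatives at $r=0$ of $D_\epsilon,K_\epsilon,\Phi_\epsilon$ have finite limits as $\epsilon\to0$ in $S$. Then $p_\epsilon=0$ and the black hole is non-extremal for all $\epsilon\in S$ sufficiently close to $0$; and if $p_\epsilon$ is the same for all $\epsilon\in S$, then this holds for every $\epsilon\in S$. (b) For a single such solution without matter, at any $\epsilon$, if $1+16\pi\epsilon\,P'(R)\,\Phi\neq0$ at $r=0$, then $p=0$ and the black hole is non-extremal. -/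

import Mathlib

open scoped ContDiff Topology

noncomputable section

namespace HorizonGeometry

/-! ### Lorentzian geometry in one chart of a four-dimensional spacetime

Signature `(-,+,+,+)`.  The Riemann tensor is
`R^a_{bcd} = ∂_c Γ^a_{db} - ∂_d Γ^a_{cb} + Γ^a_{ce} Γ^e_{db} - Γ^a_{de} Γ^e_{cb}` and
`R_{bd} = R^a_{bad}`. -/

/-- Coordinates of a point, in the order `(v, r, θ, φ)`. -/
abbrev Pt := Fin 4 → ℝ

/-- A covariant symmetric two-tensor field in the chart, given by its components. -/
abbrev MetricField := Pt → Matrix (Fin 4) (Fin 4) ℝ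

/-- The partial derivative `∂_μ f`. -/
def pd (μ : Fin 4) (f : Pt → ℝ) (x : Pt) : ℝ :=
  deriv (fun t => f (Function.update x μ t)) (x μ)

/-- The components `g^{ab}` of the inverse metric. -/
def ginv (g : MetricField) (x : Pt) (a b : Fin 4) : ℝ := (g x)⁻¹ a b

/-- The Christoffel symbol `Γ^a_{bc}`. -/
def christoffel (g : MetricField) (x : Pt) (a b c : Fin 4) : ℝ :=
  (1 / 2) * ∑ e, ginv g x a e *
    (pd b (fun y => g y e c) x + pd c (fun y => g y b e) x - pd e (fun y => g y b c) x)

/-- The Riemann tensor `R^a_{bcd}`. -/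
def riemannUp (g : MetricField) (x : Pt) (a b c d : Fin 4) : ℝ :=
  pd c (fun y => christoffel g y a d b) x - pd d (fun y => christoffel g y a c b) x
    + ∑ e, (christoffel g x a c e * christoffel g x e d b
      - christoffel g x a d e * christoffel g x e c b)

/-- The Riemann tensor `R_{abcd}`. -/
def riemann (g : MetricField) (x : Pt) (a b c d : Fin 4) : ℝ :=
  ∑ e, g x a e * riemannUp g x e b c d

/-- The Ricci tensor `R_{ab}`. -/
def ricci (g : MetricField) (x : Pt) (a b : Fin 4) : ℝ := ∑ e, riemannUp g x e a e b

/-- The trace `g^{ab} S_{ab}`. -/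
def trace (g : MetricField) (x : Pt) (S : Fin 4 → Fin 4 → ℝ) : ℝ :=
  ∑ a, ∑ b, ginv g x a b * S a b

/-- The full contraction `S^{ab} T_{ab}`. -/
def inner2 (g : MetricField) (x : Pt) (S T : Fin 4 → Fin 4 → ℝ) : ℝ :=
  ∑ a, ∑ b, ∑ c, ∑ d, ginv g x a c * ginv g x b d * S c d * T a b

/-- The contraction `R_{acbd} S^{cd}`. -/
def riemannContract (g : MetricField) (x : Pt) (S : Fin 4 → Fin 4 → ℝ) (a b : Fin 4) : ℝ :=
  inner2 g x S (fun c d => riemann g x a c b d)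

/-- The Ricci scalar `R`. -/
def ricciScalar (g : MetricField) (x : Pt) : ℝ := trace g x (ricci g x)

/-- `R_{ab} R^{ab}`. -/
def ricciSq (g : MetricField) (x : Pt) : ℝ := inner2 g x (ricci g x) (ricci g x)

/-- `R_{abcd} R^{abcd}`. -/
def riemannSq (g : MetricField) (x : Pt) : ℝ :=
  ∑ a, ∑ b, ∑ c, ∑ d, ∑ a', ∑ b', ∑ c', ∑ d',
    ginv g x a a' * ginv g x b b' * ginv g x c c' * ginv g x d d' *
      riemann g x a' b' c' d' * riemann g x a b c d

/-- The Einstein tensor `G_{ab}`. -/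
def einstein (g : MetricField) (x : Pt) (a b : Fin 4) : ℝ :=
  ricci g x a b - (1 / 2) * g x a b * ricciScalar g x

/-- The second covariant derivative `∇_a ∇_b f` of a scalar field. -/
def hess (g : MetricField) (f : Pt → ℝ) (x : Pt) (a b : Fin 4) : ℝ :=
  pd a (pd b f) x - ∑ e, christoffel g x e a b * pd e f x

/-- The wave operator `□ f = g^{ab} ∇_a ∇_b f` on scalar fields. -/
def box (g : MetricField) (f : Pt → ℝ) (x : Pt) : ℝ := trace g x (hess g f x)

/-- `∇^c f ∇_c h`. -/
def gradInner (g : MetricField) (f h : Pt → ℝ) (x : Pt) : ℝ :=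
  trace g x (fun a b => pd a f x * pd b h x)

/-- The covariant derivative `∇_c R_{ab}` of the Ricci tensor. -/
def dRicci (g : MetricField) (x : Pt) (c a b : Fin 4) : ℝ :=
  pd c (fun y => ricci g y a b) x
    - ∑ e, (christoffel g x e c a * ricci g x e b + christoffel g x e c b * ricci g x a e)

/-- The second covariant derivative `∇_d ∇_c R_{ab}` of the Ricci tensor. -/
def ddRicci (g : MetricField) (x : Pt) (d c a b : Fin 4) : ℝ :=
  pd d (fun y => dRicci g y c a b) x
    - ∑ e, (christoffel g x e d c * dRicci g x e a b + christoffel g x e d a * dRicci g x c e b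
      + christoffel g x e d b * dRicci g x c a e)

/-- `□ R_{ab}`. -/
def boxRicci (g : MetricField) (x : Pt) (a b : Fin 4) : ℝ :=
  trace g x (fun d c => ddRicci g x d c a b)

/-! ### The theories

The action is
`∫ √-g (R / (16 π) + ε Φ 𝓕 - (1/2) ∇_a Φ ∇^a Φ)` with
`𝓕 = P(R) + α₂ R_{ab} R^{ab} + α₃ R_{abcd} R^{abcd}`, `P` a real polynomial.
Modified quadratic gravity is `P = α₁ X²`; the `𝓕(R)` theories are `α₂ = α₃ = 0`. -/

/-- The curvature scalar `𝓕 = P(R) + α₂ R_{ab} R^{ab} + α₃ R_{abcd} R^{abcd}`. -/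
def curvScalar (P : Polynomial ℝ) (α₂ α₃ : ℝ) (g : MetricField) (x : Pt) : ℝ :=
  P.eval (ricciScalar g x) + α₂ * ricciSq g x + α₃ * riemannSq g x

/-- `(1/√-g) δ/δg^{ab} ∫ √-g Φ P(R)
  = P'(R) Φ R_{ab} + g_{ab} □(P'(R) Φ) - ∇_a ∇_b (P'(R) Φ) - (1/2) g_{ab} P(R) Φ`. -/
def cPoly (P : Polynomial ℝ) (g : MetricField) (Φ : Pt → ℝ) (x : Pt) (a b : Fin 4) : ℝ :=
  P.derivative.eval (ricciScalar g x) * Φ x * ricci g x a b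
    + g x a b * box g (fun y => P.derivative.eval (ricciScalar g y) * Φ y) x
    - hess g (fun y => P.derivative.eval (ricciScalar g y) * Φ y) x a b
    - (1 / 2) * g x a b * P.eval (ricciScalar g x) * Φ x

/-- `∇^c Φ ∇_c R_{ab}`. -/
def advRicci (g : MetricField) (Φ : Pt → ℝ) (x : Pt) (a b : Fin 4) : ℝ :=
  trace g x (fun c d => pd c Φ x * dRicci g x d a b)

/-- `∇^c Φ ∇_{(a} R_{b)c}`. -/
def symRicci (g : MetricField) (Φ : Pt → ℝ) (x : Pt) (a b : Fin 4) : ℝ :=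
  (1 / 2) * trace g x (fun c d => pd c Φ x * (dRicci g x a b d + dRicci g x b a d))

/-- `R_{c(a} ∇^c ∇_{b)} Φ`. -/
def ricciHess (g : MetricField) (Φ : Pt → ℝ) (x : Pt) (a b : Fin 4) : ℝ :=
  (1 / 2) * trace g x (fun c d =>
    ricci g x c a * hess g Φ x d b + ricci g x c b * hess g Φ x d a)

/-- `(1/√-g) δ/δg^{ab} ∫ √-g Φ R_{cd} R^{cd}`. -/
def cRicci (g : MetricField) (Φ : Pt → ℝ) (x : Pt) (a b : Fin 4) : ℝ :=
  Φ x * (boxRicci g x a b + 2 * riemannContract g x (ricci g x) a b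
      - (1 / 2) * g x a b * ricciSq g x + (1 / 2) * g x a b * box g (ricciScalar g) x
      - hess g (ricciScalar g) x a b)
    - (1 / 2) * (pd a Φ x * pd b (ricciScalar g) x + pd b Φ x * pd a (ricciScalar g) x)
    - 2 * symRicci g Φ x a b + 2 * advRicci g Φ x a b
    + ricci g x a b * box g Φ x - 2 * ricciHess g Φ x a b
    + g x a b * (gradInner g Φ (ricciScalar g) x + inner2 g x (ricci g x) (hess g Φ x))

/-- `(1/√-g) δ/δg^{ab} ∫ √-g Φ R_{cdef} R^{cdef}`, in four dimensions. -/
def cRiemann (g : MetricField) (Φ : Pt → ℝ) (x : Pt) (a b : Fin 4) : ℝ :=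
  Φ x * (8 * riemannContract g x (ricci g x) a b - 2 * g x a b * ricciSq g x
      + 4 * boxRicci g x a b - 2 * ricciScalar g x * ricci g x a b
      + (1 / 2) * g x a b * ricciScalar g x ^ 2 - 2 * hess g (ricciScalar g) x a b)
    - 8 * (symRicci g Φ x a b - advRicci g Φ x a b)
    + 4 * riemannContract g x (hess g Φ x) a b

/-- The tensor `C_{ab} = (1/√-g) δ/δg^{ab} ∫ √-g Φ 𝓕`. -/
def cTensor (P : Polynomial ℝ) (α₂ α₃ : ℝ) (g : MetricField) (Φ : Pt → ℝ) (x : Pt)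
    (a b : Fin 4) : ℝ :=
  cPoly P g Φ x a b + α₂ * cRicci g Φ x a b + α₃ * cRiemann g Φ x a b

/-- The stress-energy tensor of the scalar field. -/
def stressScalar (g : MetricField) (Φ : Pt → ℝ) (x : Pt) (a b : Fin 4) : ℝ :=
  pd a Φ x * pd b Φ x - (1 / 2) * g x a b * gradInner g Φ Φ x

/-! ### Static, spherically symmetric black holes near the event horizon -/

/-- The metric `-D(r) dv² + 2 dv dr + K(r) (dθ² + sin² θ dφ²)` in Gaussian null coordinates. -/
def gnMetric (D K : ℝ → ℝ) : MetricField := fun x =>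
  !![-D (x 1), 1, 0, 0;
     1, 0, 0, 0;
     0, 0, K (x 1), 0;
     0, 0, 0, K (x 1) * Real.sin (x 2) ^ 2]

/-- A radial function as a scalar field on the spacetime. -/
def radial (f : ℝ → ℝ) : Pt → ℝ := fun x => f (x 1)

/-- Points on the horizon `r = 0` (off the axis of the spherical coordinates). -/
def horizon : Set Pt := {x | x 1 = 0 ∧ Real.sin (x 2) ≠ 0}

/-- Points on the horizon or outside it, within the coordinate range `r < δ`. -/
def domain (δ : ℝ) : Set Pt := {x | 0 ≤ x 1 ∧ x 1 < δ ∧ Real.sin (x 2) ≠ 0}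

/-- A static, spherically symmetric black hole near its event horizon `r = 0`, in Gaussian null
coordinates that cover `-δ < r < δ`; the exterior is `r > 0`, where the Killing field `∂_v` is
timelike.  The metric is smooth, the horizon is a null surface with
`D(r) = r^{1+p} D₀(r)`, `p ≥ 0`, `D₀(0) ≠ 0`, and its cross sections are round spheres with
finite and positive Gaussian curvature `1 / K(0)`. -/
structure IsStaticBlackHole (δ p : ℝ) (D D₀ K : ℝ → ℝ) : Prop where
  delta_pos : 0 < δ
  smooth_D : ContDiffOn ℝ ∞ D (Set.Ioo (-δ) δ)
  smooth_D₀ : ContDiffOn ℝ ∞ D₀ (Set.Ioo (-δ) δ)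
  smooth_K : ContDiffOn ℝ ∞ K (Set.Ioo (-δ) δ)
  p_nonneg : 0 ≤ p
  D_eq : ∀ r ∈ Set.Ico 0 δ, D r = r ^ (1 + p) * D₀ r
  D₀_ne : D₀ 0 ≠ 0
  D_pos : ∀ r ∈ Set.Ioo 0 δ, 0 < D r
  K_pos : ∀ r ∈ Set.Ico 0 δ, 0 < K r

/-- The scalar field and all its derivatives are regular at the event horizon. -/
def RegularAtHorizon (δ : ℝ) (Φ : ℝ → ℝ) : Prop := ContDiffOn ℝ ∞ Φ (Set.Ioo (-δ) δ)

/-- `κ` is the surface gravity of the horizon: the Killing field `ξ = ∂_v` satisfies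
`ξ^b ∇_b ξ^a = κ ξ^a` there, that is `Γ^a_{vv} = κ δ^a_v`. -/
def IsSurfaceGravity (D K : ℝ → ℝ) (κ : ℝ) : Prop :=
  ∀ x ∈ horizon, ∀ a, christoffel (gnMetric D K) x a 0 0 = if a = 0 then κ else 0

/-- The surface gravity is nonzero and finite. -/
def NonExtremal (D K : ℝ → ℝ) : Prop := ∃ κ : ℝ, κ ≠ 0 ∧ IsSurfaceGravity D K κ

/-- The scalar field equation `□Φ + ε 𝓕 = 0` on and outside the horizon, where `𝓕` assigns to a
metric a scalar field. -/
def ScalarEquation (δ ε : ℝ) (𝓕 : MetricField → Pt → ℝ) (D K Φ : ℝ → ℝ) : Prop :=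
  ∀ x ∈ domain δ, box (gnMetric D K) (radial Φ) x + ε * 𝓕 (gnMetric D K) x = 0

/-- The gravitational equations `G_{ab} + 16 π ε C_{ab} - 8 π T^Φ_{ab} = 0` without matter, on and
outside the horizon. -/
def GravityEquations (δ ε : ℝ) (P : Polynomial ℝ) (α₂ α₃ : ℝ) (D K Φ : ℝ → ℝ) : Prop :=
  ∀ x ∈ domain δ, ∀ a b,
    einstein (gnMetric D K) x a b
      + 16 * Real.pi * ε * cTensor P α₂ α₃ (gnMetric D K) (radial Φ) x a b
      - 8 * Real.pi * stressScalar (gnMetric D K) (radial Φ) x a b = 0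

/-- A static, spherically symmetric black hole with a scalar field regular at the horizon that
solves the field equations of the theory with coupling `ε` and
`𝓕 = P(R) + α₂ R_{ab} R^{ab} + α₃ R_{abcd} R^{abcd}`, without matter. -/
structure IsRegularSolution (ε : ℝ) (P : Polynomial ℝ) (α₂ α₃ : ℝ) (δ p : ℝ)
    (D D₀ K Φ : ℝ → ℝ) : Prop where
  blackHole : IsStaticBlackHole δ p D D₀ K
  regular : RegularAtHorizon δ Φ
  gravity : GravityEquations δ ε P α₂ α₃ D K Φ
  scalar : ScalarEquation δ ε (curvScalar P α₂ α₃) D K Φ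

/-- The family `f ε` of radial functions is regular in the coupling constant at the horizon, as
`ε → 0` in `S`: its value and all its `r`-derivatives at `r = 0` have finite limits. -/
def RegularInCoupling (S : Set ℝ) (f : ℝ → ℝ → ℝ) : Prop :=
  ∀ k : ℕ, ∃ l : ℝ, Filter.Tendsto (fun ε => iteratedDeriv k (f ε) 0) (𝓝[S] 0) (𝓝 l)

end HorizonGeometry

end

/-! The surface gravity is `D'(0)/2`, and `D'(0) = 0^p * D₀ 0`, so non-extremality amounts to `p =
0`. Suppose `p ≠ 0`; then `D` and `D'` both vanish at the horizon. There `g^{rr}` and all `Γ^r_{ab}`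
vanish, so `□` kills every radial function. An `r`-derivative can only be contracted with a
`v`-index, and no matching `v`-component survives. Hence the scalar equation reduces to `ε𝓕 = 0`,
which is already absurd when `𝓕 ≠ 0`.

By the same mechanism all derivatives of `Φ` and of the curvature drop out of the `vr` and `θθ`
gravitational equations (`gravity_vr`, `gravity_thetatheta`). What remains is algebra in `a =
D''(0)/2 ≥ 0` and `b = 1/K(0) > 0`, collected in `IsRegularSolution.degenerate_equations`; the
horizon has `R = 2(b - a)`.

For quadratic `𝓕`, scale invariance cancels the coupling terms in the sum of the two gravitational
equations. This leaves `a = b`, after which the `vr` equation says `b = 0`, a contradiction. For the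
`𝓕(R)` theories, the same equations force `1 + 16πεP'(R)Φ = 0`, also with `P'(0)` in place of
`P'(R)` (`coupling_eq_zero`). Since `P'(0)` does not depend on `ε`, `Φ` at the horizon would have to
grow like `1/ε`, which regularity in the coupling forbids. -/

noncomputable section

namespace HorizonGeometry

/-! ### Arrays indexed by the coordinates -/

/-- The array with entries `a`, `b`, `c`, `d`. -/
def vec4 {α : Type*} (a b c d : α) : Fin 4 → α :=
  Fin.cases a (Fin.cases b (Fin.cases c (fun _ => d)))

theorem vec4_zero {α : Type*} (a b c d : α) : vec4 a b c d 0 = a := rfl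

theorem vec4_one {α : Type*} (a b c d : α) : vec4 a b c d 1 = b := rfl

theorem vec4_two {α : Type*} (a b c d : α) : vec4 a b c d 2 = c := rfl

theorem vec4_three {α : Type*} (a b c d : α) : vec4 a b c d 3 = d := rfl

/-- Turns a goal over all indices into goals at numerals, where the `vec4` lemmas evaluate every
table. -/
theorem forall_fin_four {p : Fin 4 → Prop} (h₀ : p 0) (h₁ : p 1) (h₂ : p 2) (h₃ : p 3) :
    ∀ a, p a := by
  intro a
  fin_cases a <;> assumption

/-! ### Partial derivatives -/

/-- The partial derivatives of a product of a function of `r` and a function of `θ`. -/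
theorem pd_separated (f T : ℝ → ℝ) (x : Pt) (μ : Fin 4) :
    pd μ (fun y => f (y 1) * T (y 2)) x =
      vec4 0 (deriv f (x 1) * T (x 2)) (f (x 1) * deriv T (x 2)) 0 μ := by
  revert μ
  refine forall_fin_four ?_ ?_ ?_ ?_ <;>
    simp [pd, vec4_zero, vec4_one, vec4_two, vec4_three]

theorem pd_radial (f : ℝ → ℝ) (x : Pt) (μ : Fin 4) :
    pd μ (fun y => f (y 1)) x = vec4 0 (deriv f (x 1)) 0 0 μ := by
  revert μ
  refine forall_fin_four ?_ ?_ ?_ ?_ <;>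
    simp [pd, vec4_zero, vec4_one, vec4_two, vec4_three]

theorem pd_const (c : ℝ) (x : Pt) (μ : Fin 4) : pd μ (fun _ => c) x = 0 := by
  simp [pd]

/-- Closed formulas for the curvature hold only where `K ≠ 0` and `sin θ ≠ 0`. Differentiating them
requires agreement on a neighbourhood, not just at a point. -/
theorem pd_congr {f h : Pt → ℝ} {x : Pt} (e : f =ᶠ[𝓝 x] h) (μ : Fin 4) :
    pd μ f x = pd μ h x := by
  have hc : Filter.Tendsto (fun t => Function.update x μ t) (𝓝 (x μ)) (𝓝 x) := by
    have : Continuous fun t => Function.update x μ t := by fun_prop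
    simpa using this.tendsto (x μ)
  exact Filter.EventuallyEq.deriv_eq (hc.eventually e)

/-! ### The Christoffel symbols -/

theorem ginv_gnMetric {D K : ℝ → ℝ} {x : Pt} (hK : K (x 1) ≠ 0) (hs : Real.sin (x 2) ≠ 0)
    (a b : Fin 4) :
    ginv (gnMetric D K) x a b =
      vec4 (vec4 0 1 0 0) (vec4 1 (D (x 1)) 0 0) (vec4 0 0 (K (x 1))⁻¹ 0)
        (vec4 0 0 0 (K (x 1) * Real.sin (x 2) ^ 2)⁻¹) a b := by
  have h : (gnMetric D K x)⁻¹ = !![0, 1, 0, 0; 1, D (x 1), 0, 0; 0, 0, (K (x 1))⁻¹, 0;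
        0, 0, 0, (K (x 1) * Real.sin (x 2) ^ 2)⁻¹] := by
    apply Matrix.inv_eq_right_inv
    ext i j
    fin_cases i <;> fin_cases j <;>
      simp [gnMetric, Matrix.mul_apply, Fin.sum_univ_four, hK]
    field_simp
  rw [ginv, h]
  revert a b
  refine forall_fin_four ?_ ?_ ?_ ?_ <;> refine forall_fin_four ?_ ?_ ?_ ?_ <;> rfl

theorem gnMetric_apply (D K : ℝ → ℝ) (x : Pt) (a b : Fin 4) :
    gnMetric D K x a b =
      vec4 (vec4 (-D (x 1)) 1 0 0) (vec4 1 0 0 0) (vec4 0 0 (K (x 1)) 0)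
        (vec4 0 0 0 (K (x 1) * Real.sin (x 2) ^ 2)) a b := by
  revert a b
  refine forall_fin_four ?_ ?_ ?_ ?_ <;> refine forall_fin_four ?_ ?_ ?_ ?_ <;> rfl

theorem deriv_sin_sq (θ : ℝ) :
    deriv (fun t => Real.sin t ^ 2) θ = 2 * Real.sin θ * Real.cos θ := by
  simp

theorem pd_gnMetric (D K : ℝ → ℝ) (x : Pt) (μ a b : Fin 4) :
    pd μ (fun y => gnMetric D K y a b) x =
      vec4 (vec4 (vec4 0 (-deriv D (x 1)) 0 0 μ) 0 0 0) 0
        (vec4 0 0 (vec4 0 (deriv K (x 1)) 0 0 μ) 0)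
        (vec4 0 0 0 (vec4 0 (deriv K (x 1) * Real.sin (x 2) ^ 2)
          (K (x 1) * (2 * Real.sin (x 2) * Real.cos (x 2))) 0 μ)) a b := by
  simp only [gnMetric_apply]
  revert a b
  refine forall_fin_four ?_ ?_ ?_ ?_ <;> refine forall_fin_four ?_ ?_ ?_ ?_ <;>
    simp only [vec4_zero, vec4_one, vec4_two, vec4_three, pd_const, Pi.zero_apply,
      pd_radial (fun r => -D r), pd_radial K, pd_separated K (fun θ => Real.sin θ ^ 2),
      deriv_sin_sq, deriv.fun_neg]

/-- The dependence of the Christoffel symbols `Γ^a_{bc}` on `r`. -/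
def chrR (D K : ℝ → ℝ) : Fin 4 → Fin 4 → Fin 4 → ℝ → ℝ :=
  vec4
    (vec4 (vec4 (fun r => deriv D r / 2) 0 0 0) 0
      (vec4 0 0 (fun r => -(deriv K r / 2)) 0) (vec4 0 0 0 (fun r => -(deriv K r / 2))))
    (vec4 (vec4 (fun r => D r * deriv D r / 2) (fun r => -(deriv D r / 2)) 0 0)
      (vec4 (fun r => -(deriv D r / 2)) 0 0 0)
      (vec4 0 0 (fun r => -(D r * deriv K r / 2)) 0)
      (vec4 0 0 0 (fun r => -(D r * deriv K r / 2))))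
    (vec4 0 (vec4 0 0 (fun r => deriv K r / (2 * K r)) 0)
      (vec4 0 (fun r => deriv K r / (2 * K r)) 0 0) (vec4 0 0 0 1))
    (vec4 0 (vec4 0 0 0 (fun r => deriv K r / (2 * K r))) (vec4 0 0 0 1)
      (vec4 0 (fun r => deriv K r / (2 * K r)) 1 0))

/-- The dependence of the Christoffel symbols `Γ^a_{bc}` on `θ`. -/
def chrT : Fin 4 → Fin 4 → Fin 4 → ℝ → ℝ :=
  vec4
    (vec4 1 1 1 (vec4 1 1 1 (fun θ => Real.sin θ ^ 2)))
    (vec4 1 1 1 (vec4 1 1 1 (fun θ => Real.sin θ ^ 2)))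
    (vec4 1 1 1 (vec4 1 1 1 (fun θ => -(Real.sin θ * Real.cos θ))))
    (vec4 1 1 (vec4 1 1 1 (fun θ => Real.cos θ / Real.sin θ))
      (vec4 1 1 (fun θ => Real.cos θ / Real.sin θ) 1))

/-- Each symbol separates into a function of `r` times a function of `θ`, so two tables of
one-variable derivatives suffice for the curvature. -/
theorem christoffel_gnMetric {D K : ℝ → ℝ} {x : Pt} (hK : K (x 1) ≠ 0)
    (hs : Real.sin (x 2) ≠ 0) (a b c : Fin 4) :
    christoffel (gnMetric D K) x a b c = chrR D K a b c (x 1) * chrT a b c (x 2) := by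
  simp only [christoffel, Fin.sum_univ_four, ginv_gnMetric hK hs, pd_gnMetric]
  revert a b c
  refine forall_fin_four ?_ ?_ ?_ ?_ <;> refine forall_fin_four ?_ ?_ ?_ ?_ <;>
    refine forall_fin_four ?_ ?_ ?_ ?_ <;>
    simp only [chrR, chrT, vec4_zero, vec4_one, vec4_two, vec4_three, Pi.zero_apply,
      Pi.one_apply, zero_mul, mul_zero, add_zero, zero_add, sub_zero, zero_sub, mul_one] <;>
    field_simp

/-- The functions `D` and `K` are twice differentiable at `r`, and `K` does not vanish there. -/
structure RegularRadius (D K : ℝ → ℝ) (r : ℝ) : Prop where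
  diff_D : DifferentiableAt ℝ D r
  diff_D' : DifferentiableAt ℝ (deriv D) r
  diff_K : DifferentiableAt ℝ K r
  diff_K' : DifferentiableAt ℝ (deriv K) r
  K_ne : K r ≠ 0

/-- The `r`-derivatives of `chrR`. -/
def chrR' (D K : ℝ → ℝ) (r : ℝ) : Fin 4 → Fin 4 → Fin 4 → ℝ :=
  vec4
    (vec4 (vec4 (deriv (deriv D) r / 2) 0 0 0) 0
      (vec4 0 0 (-(deriv (deriv K) r / 2)) 0) (vec4 0 0 0 (-(deriv (deriv K) r / 2))))
    (vec4 (vec4 ((deriv D r ^ 2 + D r * deriv (deriv D) r) / 2) (-(deriv (deriv D) r / 2)) 0 0)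
      (vec4 (-(deriv (deriv D) r / 2)) 0 0 0)
      (vec4 0 0 (-((deriv D r * deriv K r + D r * deriv (deriv K) r) / 2)) 0)
      (vec4 0 0 0 (-((deriv D r * deriv K r + D r * deriv (deriv K) r) / 2))))
    (vec4 0 (vec4 0 0 ((deriv (deriv K) r * K r - deriv K r ^ 2) / (2 * K r ^ 2)) 0)
      (vec4 0 ((deriv (deriv K) r * K r - deriv K r ^ 2) / (2 * K r ^ 2)) 0 0) 0)
    (vec4 0 (vec4 0 0 0 ((deriv (deriv K) r * K r - deriv K r ^ 2) / (2 * K r ^ 2))) 0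
      (vec4 0 ((deriv (deriv K) r * K r - deriv K r ^ 2) / (2 * K r ^ 2)) 0 0))

theorem deriv_chrR {D K : ℝ → ℝ} {r : ℝ} (h : RegularRadius D K r) (a b c : Fin 4) :
    deriv (chrR D K a b c) r = chrR' D K r a b c := by
  have hD := h.diff_D.hasDerivAt
  have hD' := h.diff_D'.hasDerivAt
  have hK := h.diff_K.hasDerivAt
  have hK' := h.diff_K'.hasDerivAt
  have e₁ := (hD'.div_const 2).deriv
  have e₂ := (hK'.div_const 2).fun_neg.deriv
  have e₃ := ((hD.fun_mul hD').div_const 2).deriv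
  have e₄ := (hD'.div_const 2).fun_neg.deriv
  have e₅ := ((hD.fun_mul hK').div_const 2).fun_neg.deriv
  have e₆ := (hK'.fun_div (hK.const_mul 2) (by simpa using h.K_ne)).deriv
  have e₀ : deriv (0 : ℝ → ℝ) r = 0 := by simp
  have e₇ : deriv (1 : ℝ → ℝ) r = 0 := deriv_const r (1 : ℝ)
  have hK0 := h.K_ne
  revert a b c
  refine forall_fin_four ?_ ?_ ?_ ?_ <;> refine forall_fin_four ?_ ?_ ?_ ?_ <;>
    refine forall_fin_four ?_ ?_ ?_ ?_ <;>
    simp only [chrR, chrR', vec4_zero, vec4_one, vec4_two, vec4_three, Pi.zero_apply,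
      e₀, e₁, e₂, e₃, e₄, e₅, e₆, e₇] <;>
    field_simp

/-- The `θ`-derivatives of `chrT`. -/
def chrT' (θ : ℝ) : Fin 4 → Fin 4 → Fin 4 → ℝ :=
  vec4
    (vec4 0 0 0 (vec4 0 0 0 (2 * Real.sin θ * Real.cos θ)))
    (vec4 0 0 0 (vec4 0 0 0 (2 * Real.sin θ * Real.cos θ)))
    (vec4 0 0 0 (vec4 0 0 0 (Real.sin θ ^ 2 - Real.cos θ ^ 2)))
    (vec4 0 0 (vec4 0 0 0 (-(Real.sin θ ^ 2)⁻¹)) (vec4 0 0 (-(Real.sin θ ^ 2)⁻¹) 0))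

theorem deriv_chrT {θ : ℝ} (h : Real.sin θ ≠ 0) (a b c : Fin 4) :
    deriv (chrT a b c) θ = chrT' θ a b c := by
  have hs := Real.hasDerivAt_sin θ
  have hc := Real.hasDerivAt_cos θ
  have e₁ : deriv (fun t => -(Real.sin t * Real.cos t)) θ =
      Real.sin θ ^ 2 - Real.cos θ ^ 2 := by
    rw [(hs.fun_mul hc).fun_neg.deriv]; ring
  have e₂ : deriv (fun t => Real.cos t / Real.sin t) θ = -(Real.sin θ ^ 2)⁻¹ := by
    rw [(hc.fun_div hs h).deriv]
    field_simp
    linarith [Real.sin_sq_add_cos_sq θ]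
  have e₀ : deriv (1 : ℝ → ℝ) θ = 0 := deriv_const θ (1 : ℝ)
  revert a b c
  refine forall_fin_four ?_ ?_ ?_ ?_ <;> refine forall_fin_four ?_ ?_ ?_ ?_ <;>
    refine forall_fin_four ?_ ?_ ?_ ?_ <;>
    simp only [chrT, chrT', vec4_zero, vec4_one, vec4_two, vec4_three, Pi.zero_apply,
      Pi.one_apply, e₀, e₁, e₂, deriv_sin_sq]

/-! ### The curvature -/

theorem pd_christoffel {D K : ℝ → ℝ} {x : Pt}
    (hx : ∀ᶠ y in 𝓝 x, RegularRadius D K (y 1) ∧ Real.sin (y 2) ≠ 0) (μ a b c : Fin 4) :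
    pd μ (fun y => christoffel (gnMetric D K) y a b c) x =
      vec4 0 (chrR' D K (x 1) a b c * chrT a b c (x 2))
        (chrR D K a b c (x 1) * chrT' (x 2) a b c) 0 μ := by
  rw [pd_congr (hx.mono fun y hy => christoffel_gnMetric hy.1.K_ne hy.2 a b c), pd_separated,
    deriv_chrR hx.self_of_nhds.1, deriv_chrT hx.self_of_nhds.2]

theorem riemannUp_gnMetric {D K : ℝ → ℝ} {x : Pt}
    (hx : ∀ᶠ y in 𝓝 x, RegularRadius D K (y 1) ∧ Real.sin (y 2) ≠ 0) (a b c d : Fin 4) :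
    riemannUp (gnMetric D K) x a b c d =
      vec4 0 (chrR' D K (x 1) a d b * chrT a d b (x 2))
        (chrR D K a d b (x 1) * chrT' (x 2) a d b) 0 c
      - vec4 0 (chrR' D K (x 1) a c b * chrT a c b (x 2))
        (chrR D K a c b (x 1) * chrT' (x 2) a c b) 0 d
      + ∑ e, (chrR D K a c e (x 1) * chrT a c e (x 2) * (chrR D K e d b (x 1) * chrT e d b (x 2))
        - chrR D K a d e (x 1) * chrT a d e (x 2) *
          (chrR D K e c b (x 1) * chrT e c b (x 2))) := by
  have h0 := hx.self_of_nhds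
  simp only [riemannUp, pd_christoffel hx, christoffel_gnMetric h0.1.K_ne h0.2]

/-- The component `-R_{vr}` of the Ricci tensor. -/
def ricH (D K : ℝ → ℝ) (r : ℝ) : ℝ :=
  (deriv (deriv D) r + deriv D r * deriv K r / K r) / 2

/-- The component `R_{rr}` of the Ricci tensor. -/
def ricQ (K : ℝ → ℝ) (r : ℝ) : ℝ :=
  -(deriv (deriv K) r / K r) + deriv K r ^ 2 / (2 * K r ^ 2)

/-- The component `R_{θθ}` of the Ricci tensor. -/
def ricW (D K : ℝ → ℝ) (r : ℝ) : ℝ :=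
  1 - (deriv D r * deriv K r + D r * deriv (deriv K) r) / 2

/-- The components `R_{ab}` of the Ricci tensor. -/
def ricTable (D K : ℝ → ℝ) (r θ : ℝ) : Fin 4 → Fin 4 → ℝ :=
  vec4 (vec4 (D r * ricH D K r) (-ricH D K r) 0 0) (vec4 (-ricH D K r) (ricQ K r) 0 0)
    (vec4 0 0 (ricW D K r) 0) (vec4 0 0 0 (ricW D K r * Real.sin θ ^ 2))

theorem ricci_gnMetric {D K : ℝ → ℝ} {x : Pt}
    (hx : ∀ᶠ y in 𝓝 x, RegularRadius D K (y 1) ∧ Real.sin (y 2) ≠ 0) (a b : Fin 4) :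
    ricci (gnMetric D K) x a b = ricTable D K (x 1) (x 2) a b := by
  have hK := hx.self_of_nhds.1.K_ne
  have hs := hx.self_of_nhds.2
  have hc : Real.cos (x 2) ^ 2 = 1 - Real.sin (x 2) ^ 2 := by
    linarith [Real.sin_sq_add_cos_sq (x 2)]
  simp only [ricci, riemannUp_gnMetric hx, Fin.sum_univ_four]
  revert a b
  refine forall_fin_four ?_ ?_ ?_ ?_ <;> refine forall_fin_four ?_ ?_ ?_ ?_ <;>
    simp only [chrR, chrT, chrR', chrT', ricTable, ricH, ricQ, ricW, vec4_zero, vec4_one,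
      vec4_two, vec4_three, Pi.zero_apply, Pi.one_apply, zero_mul, mul_zero, add_zero, zero_add,
      sub_zero, zero_sub, mul_one, one_mul, sub_self] <;>
    field_simp <;> (try rw [hc]) <;> ring

theorem ricciScalar_gnMetric {D K : ℝ → ℝ} {x : Pt}
    (hx : ∀ᶠ y in 𝓝 x, RegularRadius D K (y 1) ∧ Real.sin (y 2) ≠ 0) :
    ricciScalar (gnMetric D K) x =
      -2 * ricH D K (x 1) + D (x 1) * (ricQ K (x 1)) + 2 * ricW D K (x 1) / K (x 1) := by
  have hK := hx.self_of_nhds.1.K_ne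
  have hs := hx.self_of_nhds.2
  simp only [ricciScalar, trace, ricci_gnMetric hx, Fin.sum_univ_four, ginv_gnMetric hK hs,
    ricTable, vec4_zero, vec4_one, vec4_two, vec4_three, zero_mul, mul_zero, add_zero, zero_add,
    one_mul]
  field_simp
  ring

/-! ### Derivatives of the Ricci tensor -/

theorem pd_chart (G : ℝ → ℝ → ℝ) (x : Pt) (μ : Fin 4) :
    pd μ (fun y => G (y 1) (y 2)) x =
      vec4 0 (deriv (fun r => G r (x 2)) (x 1)) (deriv (G (x 1)) (x 2)) 0 μ := by
  revert μ
  refine forall_fin_four ?_ ?_ ?_ ?_ <;>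
    simp [pd, vec4_zero, vec4_one, vec4_two, vec4_three]

/-- The components of `∇_c R_{ab}`. -/
def dRicTable (D K : ℝ → ℝ) (c a b : Fin 4) (r θ : ℝ) : ℝ :=
  vec4 0 (deriv (fun t => ricTable D K t θ a b) r) (deriv (fun t => ricTable D K r t a b) θ) 0 c
    - ∑ e, (chrR D K e c a r * chrT e c a θ * ricTable D K r θ e b
      + chrR D K e c b r * chrT e c b θ * ricTable D K r θ a e)

theorem dRicci_gnMetric {D K : ℝ → ℝ} {x : Pt}
    (hx : ∀ᶠ y in 𝓝 x, RegularRadius D K (y 1) ∧ Real.sin (y 2) ≠ 0) (c a b : Fin 4) :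
    dRicci (gnMetric D K) x c a b = dRicTable D K c a b (x 1) (x 2) := by
  have h0 := hx.self_of_nhds
  rw [dRicci, dRicTable, pd_congr (hx.eventually_nhds.mono fun y hy => ricci_gnMetric hy a b),
    pd_chart fun r θ => ricTable D K r θ a b]
  simp only [christoffel_gnMetric h0.1.K_ne h0.2, ricci_gnMetric hx]

/-- Every entry carries a factor `D'`, so all vanish at a degenerate horizon. The `vr` entry carries
`D * D'`, so its `r`-derivative vanishes there too, as `boxRicci_vr` needs. -/
theorem dRicTable_v {D K : ℝ → ℝ} {r θ : ℝ} (a b : Fin 4) :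
    dRicTable D K 0 a b r θ =
      vec4 (vec4 0 (-(D r * (deriv D r * ricQ K r)) / 2) 0 0)
        (vec4 (-(D r * (deriv D r * ricQ K r)) / 2) (deriv D r * ricQ K r) 0 0) 0 0 a b := by
  simp only [dRicTable, Fin.sum_univ_four]
  revert a b
  refine forall_fin_four ?_ ?_ ?_ ?_ <;> refine forall_fin_four ?_ ?_ ?_ ?_ <;>
    simp only [chrR, chrT, ricTable, vec4_zero, vec4_one, vec4_two, vec4_three, Pi.zero_apply,
      Pi.one_apply, zero_mul, mul_zero, add_zero, zero_add, mul_one, sub_self] <;>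
    ring

/-- The component `∇_θ R_{rθ}`. -/
def ricX (D K : ℝ → ℝ) (r : ℝ) : ℝ :=
  -(deriv K r / (2 * K r) * ricW D K r) - deriv K r / 2 * ricH D K r
    + D r * deriv K r / 2 * ricQ K r

theorem dRicTable_theta {D K : ℝ → ℝ} {r θ : ℝ} (a b : Fin 4) :
    dRicTable D K 2 a b r θ =
      vec4 0 (vec4 0 0 (ricX D K r) 0) (vec4 0 (ricX D K r) 0 0) 0 a b := by
  simp only [dRicTable, Fin.sum_univ_four]
  have hd : deriv (fun t => ricW D K r * Real.sin t ^ 2) θ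
      = ricW D K r * (2 * Real.sin θ * Real.cos θ) := by
    rw [deriv_const_mul_field, deriv_sin_sq]
  revert a b
  refine forall_fin_four ?_ ?_ ?_ ?_ <;> refine forall_fin_four ?_ ?_ ?_ ?_ <;>
    simp only [chrR, chrT, ricTable, ricX, hd, deriv_const, vec4_zero, vec4_one, vec4_two,
      vec4_three, Pi.zero_apply,
      Pi.one_apply, zero_mul, mul_zero, add_zero, zero_add, mul_one, one_mul, sub_self] <;>
    field_simp <;> ring

theorem dRicTable_phi {D K : ℝ → ℝ} {r θ : ℝ} (a b : Fin 4) :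
    dRicTable D K 3 a b r θ =
      vec4 0 (vec4 0 0 0 (ricX D K r * Real.sin θ ^ 2)) 0
        (vec4 0 (ricX D K r * Real.sin θ ^ 2) 0 0) a b := by
  simp only [dRicTable, Fin.sum_univ_four]
  revert a b
  refine forall_fin_four ?_ ?_ ?_ ?_ <;> refine forall_fin_four ?_ ?_ ?_ ?_ <;>
    simp only [chrR, chrT, ricTable, ricX, vec4_zero, vec4_one, vec4_two, vec4_three,
      Pi.zero_apply,
      Pi.one_apply, zero_mul, mul_zero, add_zero, zero_add, mul_one, one_mul, sub_self] <;>
    field_simp <;> ring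

/-! ### The geometry at a degenerate horizon -/

/-- A point on the equator of a sphere on which `D` has a double zero. -/
structure DegeneratePoint (D K : ℝ → ℝ) (x : Pt) : Prop where
  near : ∀ᶠ y in 𝓝 x, RegularRadius D K (y 1) ∧ Real.sin (y 2) ≠ 0
  D_eq : D (x 1) = 0
  D'_eq : deriv D (x 1) = 0
  sin_eq : Real.sin (x 2) = 1
  cos_eq : Real.cos (x 2) = 0
  diff_H : DifferentiableAt ℝ (ricH D K) (x 1)
  diff_Q : DifferentiableAt ℝ (ricQ K) (x 1)

namespace DegeneratePoint

variable {D K : ℝ → ℝ} {x : Pt}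

theorem K_ne (h : DegeneratePoint D K x) : K (x 1) ≠ 0 := h.near.self_of_nhds.1.K_ne

theorem sin_ne (h : DegeneratePoint D K x) : Real.sin (x 2) ≠ 0 := h.near.self_of_nhds.2

theorem metric (h : DegeneratePoint D K x) (a b : Fin 4) :
    gnMetric D K x a b =
      vec4 (vec4 0 1 0 0) (vec4 1 0 0 0) (vec4 0 0 (K (x 1)) 0) (vec4 0 0 0 (K (x 1))) a b := by
  simp only [gnMetric_apply, h.D_eq, h.sin_eq, one_pow, mul_one, neg_zero]

theorem ginv (h : DegeneratePoint D K x) (a b : Fin 4) :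
    ginv (gnMetric D K) x a b =
      vec4 (vec4 0 1 0 0) (vec4 1 0 0 0) (vec4 0 0 (K (x 1))⁻¹ 0)
        (vec4 0 0 0 (K (x 1))⁻¹) a b := by
  simp only [ginv_gnMetric h.K_ne h.sin_ne, h.D_eq, h.sin_eq, one_pow, mul_one]

theorem christoffel (h : DegeneratePoint D K x) (a b c : Fin 4) :
    christoffel (gnMetric D K) x a b c =
      vec4 (vec4 0 0 (vec4 0 0 (-(deriv K (x 1) / 2)) 0) (vec4 0 0 0 (-(deriv K (x 1) / 2))))
        0
        (vec4 0 (vec4 0 0 (deriv K (x 1) / (2 * K (x 1))) 0)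
          (vec4 0 (deriv K (x 1) / (2 * K (x 1))) 0 0) 0)
        (vec4 0 (vec4 0 0 0 (deriv K (x 1) / (2 * K (x 1)))) 0
          (vec4 0 (deriv K (x 1) / (2 * K (x 1))) 0 0)) a b c := by
  simp only [christoffel_gnMetric h.K_ne h.sin_ne]
  revert a b c
  refine forall_fin_four ?_ ?_ ?_ ?_ <;> refine forall_fin_four ?_ ?_ ?_ ?_ <;>
    refine forall_fin_four ?_ ?_ ?_ ?_ <;>
    simp only [chrR, chrT, vec4_zero, vec4_one, vec4_two, vec4_three, Pi.zero_apply,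
      Pi.one_apply, h.D_eq, h.D'_eq, h.sin_eq, h.cos_eq, one_pow, mul_one, zero_mul, mul_zero,
      zero_div, neg_zero]

theorem ricci (h : DegeneratePoint D K x) (a b : Fin 4) :
    ricci (gnMetric D K) x a b =
      vec4 (vec4 0 (-(deriv (deriv D) (x 1) / 2)) 0 0)
        (vec4 (-(deriv (deriv D) (x 1) / 2)) (ricQ K (x 1)) 0 0) (vec4 0 0 1 0)
        (vec4 0 0 0 1) a b := by
  simp only [ricci_gnMetric h.near, ricTable, ricH, ricW, h.D_eq, h.D'_eq, h.sin_eq, one_pow,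
    mul_one, zero_mul, zero_div, add_zero, sub_zero]

theorem ricciScalar (h : DegeneratePoint D K x) :
    ricciScalar (gnMetric D K) x = 2 * (K (x 1))⁻¹ - deriv (deriv D) (x 1) := by
  have := h.K_ne
  simp only [ricciScalar_gnMetric h.near, ricH, ricW, h.D_eq, h.D'_eq, zero_mul, zero_div,
    add_zero, sub_zero]
  field_simp
  ring

/-- The Riemann tensor `R_{abcd}`: `A = D''(0)`, `k = K(0)`, `X = R_{rθrθ}`. -/
def rmTable (A k X : ℝ) (a b c d : Fin 4) : ℝ :=
  let η : Fin 4 → Fin 4 → ℝ := vec4 (vec4 0 1 0 0) (vec4 1 0 0 0) 0 0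
  let s : Fin 4 → Fin 4 → ℝ := vec4 0 0 (vec4 0 0 1 0) (vec4 0 0 0 1)
  let n : Fin 4 → Fin 4 → ℝ := vec4 0 (vec4 0 1 0 0) 0 0
  k * (s a c * s b d - s a d * s b c) - A / 2 * (η a c * η b d - η a d * η b c)
    + X * (n a c * s b d - n a d * s b c - n b c * s a d + n b d * s a c)

-- The first two terms of `rmTable` are the curvatures of the sphere and of the `(v, r)` plane. The
-- term in `X` carries two lower `r` indices, so it is seen only by a factor with a `vv` component;
-- none occurs below.
set_option maxHeartbeats 2000000 in
theorem riemann (h : DegeneratePoint D K x) (a b c d : Fin 4) :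
    riemann (gnMetric D K) x a b c d =
      rmTable (deriv (deriv D) (x 1)) (K (x 1))
        (deriv K (x 1) ^ 2 / (4 * K (x 1)) - deriv (deriv K) (x 1) / 2) a b c d := by
  have hK := h.K_ne
  simp only [HorizonGeometry.riemann, riemannUp_gnMetric h.near, Fin.sum_univ_four, h.metric]
  revert a b c d
  refine forall_fin_four ?_ ?_ ?_ ?_ <;> refine forall_fin_four ?_ ?_ ?_ ?_ <;>
    refine forall_fin_four ?_ ?_ ?_ ?_ <;> refine forall_fin_four ?_ ?_ ?_ ?_ <;>
    simp only [chrR, chrT, chrR', chrT', rmTable, vec4_zero, vec4_one, vec4_two, vec4_three,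
      Pi.zero_apply,
      Pi.one_apply, h.D_eq, h.D'_eq, h.sin_eq, h.cos_eq, one_pow, mul_one, zero_mul, mul_zero,
      zero_div, neg_zero, add_zero, zero_add, sub_zero, zero_sub, sub_self, one_mul] <;>
    field_simp <;> ring

end DegeneratePoint

namespace DegeneratePoint

variable {D K : ℝ → ℝ} {x : Pt}

/-! ### Contractions and scalar fields at a degenerate horizon -/

theorem trace (h : DegeneratePoint D K x) (S : Fin 4 → Fin 4 → ℝ) :
    trace (gnMetric D K) x S = S 0 1 + S 1 0 + (K (x 1))⁻¹ * (S 2 2 + S 3 3) := by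
  simp only [HorizonGeometry.trace, Fin.sum_univ_four, h.ginv, vec4_zero, vec4_one, vec4_two,
    vec4_three, zero_mul, add_zero, zero_add, one_mul]
  ring

theorem inner2 (h : DegeneratePoint D K x) (S T : Fin 4 → Fin 4 → ℝ) :
    inner2 (gnMetric D K) x S T =
      S 1 1 * T 0 0 + S 1 0 * T 0 1 + S 0 1 * T 1 0 + S 0 0 * T 1 1
        + (K (x 1))⁻¹ * (S 1 2 * T 0 2 + S 1 3 * T 0 3 + S 0 2 * T 1 2 + S 0 3 * T 1 3
          + S 2 1 * T 2 0 + S 2 0 * T 2 1 + S 3 1 * T 3 0 + S 3 0 * T 3 1)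
        + (K (x 1))⁻¹ ^ 2 * (S 2 2 * T 2 2 + S 2 3 * T 2 3 + S 3 2 * T 3 2 + S 3 3 * T 3 3) := by
  simp only [HorizonGeometry.inner2, Fin.sum_univ_four, h.ginv, vec4_zero, vec4_one, vec4_two,
    vec4_three, zero_mul, mul_zero, add_zero, zero_add, one_mul, mul_one]
  ring

theorem pd_eventually {f : Pt → ℝ} {F : ℝ → ℝ} (hf : f =ᶠ[𝓝 x] radial F)
    (μ : Fin 4) : pd μ f =ᶠ[𝓝 x] fun y => vec4 0 (deriv F (y 1)) 0 0 μ :=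
  hf.eventually_nhds.mono fun y hy => (pd_congr hy μ).trans (pd_radial F y μ)

/-- All `Γ^r_{ab}` vanish here, leaving only the `rr` component; as `g^{rr} = D = 0`, `□` then
vanishes on radial functions. -/
theorem hess (h : DegeneratePoint D K x) {f : Pt → ℝ} {F : ℝ → ℝ}
    (hf : f =ᶠ[𝓝 x] radial F) (a b : Fin 4) :
    hess (gnMetric D K) f x a b =
      vec4 0 (vec4 0 (deriv (deriv F) (x 1)) 0 0) 0 0 a b := by
  simp only [HorizonGeometry.hess, pd_congr (pd_eventually hf _), h.christoffel,
    Fin.sum_univ_four, (pd_eventually hf _).self_of_nhds]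
  revert a b
  refine forall_fin_four ?_ ?_ ?_ ?_ <;> refine forall_fin_four ?_ ?_ ?_ ?_ <;>
    simp only [vec4_zero, vec4_one, vec4_two, vec4_three, pd_const, pd_radial (deriv F),
      Pi.zero_apply, mul_zero, zero_mul, add_zero, sub_zero]

theorem box (h : DegeneratePoint D K x) {f : Pt → ℝ} {F : ℝ → ℝ}
    (hf : f =ᶠ[𝓝 x] radial F) : box (gnMetric D K) f x = 0 := by
  simp only [HorizonGeometry.box, h.trace, h.hess hf, vec4_zero, vec4_one, vec4_two, vec4_three,
    Pi.zero_apply, add_zero, mul_zero]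

theorem gradInner (h : DegeneratePoint D K x) {f f' : Pt → ℝ} {F F' : ℝ → ℝ}
    (hf : f =ᶠ[𝓝 x] radial F) (hf' : f' =ᶠ[𝓝 x] radial F') :
    gradInner (gnMetric D K) f f' x = 0 := by
  simp only [HorizonGeometry.gradInner, h.trace, (pd_eventually hf _).self_of_nhds,
    (pd_eventually hf' _).self_of_nhds, vec4_zero, vec4_one, vec4_two, vec4_three,
    add_zero, mul_zero, zero_mul]

theorem ricciScalar_eventually (h : DegeneratePoint D K x) :
    HorizonGeometry.ricciScalar (gnMetric D K) =ᶠ[𝓝 x] radial fun r =>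
      -2 * ricH D K r + D r * ricQ K r + 2 * ricW D K r / K r :=
  h.near.eventually_nhds.mono fun _ hy => ricciScalar_gnMetric hy

theorem ricciSq (h : DegeneratePoint D K x) :
    ricciSq (gnMetric D K) x = deriv (deriv D) (x 1) ^ 2 / 2 + 2 * (K (x 1))⁻¹ ^ 2 := by
  simp only [HorizonGeometry.ricciSq, h.inner2, h.ricci, vec4_zero, vec4_one, vec4_two,
    vec4_three]
  ring

/-- With `D = 0`, raising an index swaps `v` and `r` and rescales the angles. This collapses the
eightfold sum in `riemannSq` to a fourfold one. -/
theorem sum_ginv (h : DegeneratePoint D K x) (a : Fin 4) (f : Fin 4 → ℝ) :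
    ∑ b, HorizonGeometry.ginv (gnMetric D K) x a b * f b =
      vec4 1 1 (K (x 1))⁻¹ (K (x 1))⁻¹ a * f (vec4 1 0 2 3 a) := by
  simp only [Fin.sum_univ_four, h.ginv]
  revert a
  refine forall_fin_four ?_ ?_ ?_ ?_ <;>
    simp only [vec4_zero, vec4_one, vec4_two, vec4_three, zero_mul, add_zero, zero_add]

set_option maxHeartbeats 2000000 in
theorem riemannSq (h : DegeneratePoint D K x) :
    riemannSq (gnMetric D K) x = deriv (deriv D) (x 1) ^ 2 + 4 * (K (x 1))⁻¹ ^ 2 := by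
  have hK := h.K_ne
  have e : HorizonGeometry.riemannSq (gnMetric D K) x = ∑ a, ∑ b, ∑ c, ∑ d,
      (∑ a', HorizonGeometry.ginv (gnMetric D K) x a a' *
        ∑ b', HorizonGeometry.ginv (gnMetric D K) x b b' *
        ∑ c', HorizonGeometry.ginv (gnMetric D K) x c c' *
        ∑ d', HorizonGeometry.ginv (gnMetric D K) x d d' *
          HorizonGeometry.riemann (gnMetric D K) x a' b' c' d') *
        HorizonGeometry.riemann (gnMetric D K) x a b c d := by
    simp only [HorizonGeometry.riemannSq, Finset.mul_sum, Finset.sum_mul, mul_assoc]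
  rw [e]
  simp only [h.sum_ginv, h.riemann]
  simp only [Fin.sum_univ_four, rmTable, vec4_zero, vec4_one, vec4_two, vec4_three, zero_mul,
    mul_zero, add_zero, zero_add, sub_zero, zero_sub, sub_self, Pi.zero_apply, mul_one, one_mul]
  field_simp
  ring

theorem riemannContract_vr (h : DegeneratePoint D K x) (S : Fin 4 → Fin 4 → ℝ) :
    riemannContract (gnMetric D K) x S 0 1 = -(deriv (deriv D) (x 1) / 2) * S 0 1 := by
  simp only [riemannContract, h.inner2, h.riemann, rmTable, vec4_zero, vec4_one, vec4_two,
    vec4_three, Pi.zero_apply]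
  ring

theorem riemannContract_thetatheta (h : DegeneratePoint D K x) (S : Fin 4 → Fin 4 → ℝ) :
    riemannContract (gnMetric D K) x S 2 2 = (K (x 1))⁻¹ * S 3 3
      + (deriv K (x 1) ^ 2 / (4 * K (x 1)) - deriv (deriv K) (x 1) / 2) * S 0 0 := by
  have hK := h.K_ne
  simp only [riemannContract, h.inner2, h.riemann, rmTable, vec4_zero, vec4_one, vec4_two,
    vec4_three, Pi.zero_apply]
  field_simp
  ring

/-! ### Derivatives of the Ricci tensor at a degenerate horizon -/

theorem dRicci_eventually (h : DegeneratePoint D K x) (c a b : Fin 4) :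
    (fun y => dRicci (gnMetric D K) y c a b) =ᶠ[𝓝 x]
      fun y => dRicTable D K c a b (y 1) (y 2) :=
  h.near.eventually_nhds.mono fun _ hy => dRicci_gnMetric hy c a b

theorem dRicci_v (h : DegeneratePoint D K x) (a b : Fin 4) :
    dRicci (gnMetric D K) x 0 a b = 0 := by
  rw [dRicci_gnMetric h.near, dRicTable_v]
  revert a b
  refine forall_fin_four ?_ ?_ ?_ ?_ <;> refine forall_fin_four ?_ ?_ ?_ ?_ <;>
    simp only [vec4_zero, vec4_one, vec4_two, vec4_three, Pi.zero_apply, h.D_eq, h.D'_eq,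
      zero_mul, neg_zero, zero_div]

/-- The only `∇_r R_{ab}` entering the `vr` equation: it multiplies `∂_r Φ` in `symRicci`. -/
theorem dRicci_r_vv (h : DegeneratePoint D K x) : dRicci (gnMetric D K) x 1 0 0 = 0 := by
  have e : deriv (fun r => D r * ricH D K r) (x 1) = 0 := by
    rw [(h.near.self_of_nhds.1.diff_D.hasDerivAt.fun_mul h.diff_H.hasDerivAt).deriv, h.D_eq,
      h.D'_eq]
    simp
  simp only [dRicci_gnMetric h.near, dRicTable, Fin.sum_univ_four, chrR, chrT, ricTable, e,
    vec4_zero, vec4_one, vec4_two, vec4_three, Pi.zero_apply, h.D'_eq]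
  simp

theorem dRicci_theta (h : DegeneratePoint D K x) (a b : Fin 4) :
    dRicci (gnMetric D K) x 2 a b =
      vec4 0 (vec4 0 0 (ricX D K (x 1)) 0) (vec4 0 (ricX D K (x 1)) 0 0) 0 a b := by
  rw [dRicci_gnMetric h.near, dRicTable_theta]

theorem dRicci_phi (h : DegeneratePoint D K x) (a b : Fin 4) :
    dRicci (gnMetric D K) x 3 a b =
      vec4 0 (vec4 0 0 0 (ricX D K (x 1))) 0 (vec4 0 (ricX D K (x 1)) 0 0) a b := by
  rw [dRicci_gnMetric h.near, dRicTable_phi, h.sin_eq, one_pow, mul_one]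

theorem pd_dRicci_v (h : DegeneratePoint D K x) (c a b : Fin 4) :
    pd 0 (fun y => dRicci (gnMetric D K) y c a b) x = 0 := by
  rw [pd_congr (h.dRicci_eventually c a b), pd_chart, vec4_zero]

theorem pd_dRicci_phi (h : DegeneratePoint D K x) (c a b : Fin 4) :
    pd 3 (fun y => dRicci (gnMetric D K) y c a b) x = 0 := by
  rw [pd_congr (h.dRicci_eventually c a b), pd_chart, vec4_three]

/-- All `Γ^a_{vb}` and all `∇_v R_{ab}` vanish at the point, so the `v`-`r` pairs contribute only
the `r`-derivative of an expression proportional to `D * D'`. The angular connection terms meet only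
vanishing components. -/
theorem boxRicci_vr (h : DegeneratePoint D K x) : boxRicci (gnMetric D K) x 0 1 = 0 := by
  have h0 := h.near.self_of_nhds.1
  have e₁ : pd 1 (fun y => dRicci (gnMetric D K) y 0 0 1) x = 0 := by
    rw [pd_congr (h.dRicci_eventually 0 0 1), pd_chart, vec4_one]
    simp only [dRicTable_v, vec4_zero, vec4_one]
    rw [((h0.diff_D.hasDerivAt.fun_mul
      (h0.diff_D'.hasDerivAt.fun_mul h.diff_Q.hasDerivAt)).fun_neg.div_const 2).deriv]
    simp [h.D_eq, h.D'_eq]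
  have e₂ : pd 2 (fun y => dRicci (gnMetric D K) y 2 0 1) x = 0 := by
    rw [pd_congr (h.dRicci_eventually 2 0 1), pd_chart, vec4_two]
    simp only [funext fun θ => dRicTable_theta (D := D) (K := K) (r := x 1) (θ := θ) 0 1]
    simp [vec4_zero]
  simp only [boxRicci, h.trace, ddRicci, e₁, e₂, h.pd_dRicci_v, h.pd_dRicci_phi,
    Fin.sum_univ_four, h.christoffel, h.dRicci_v, h.dRicci_theta, h.dRicci_phi,
    vec4_zero, vec4_one, vec4_two, vec4_three, Pi.zero_apply]
  simp

theorem boxRicci_thetatheta (h : DegeneratePoint D K x) :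
    boxRicci (gnMetric D K) x 2 2 = 0 := by
  have e₁ : pd 1 (fun y => dRicci (gnMetric D K) y 0 2 2) x = 0 := by
    rw [pd_congr (h.dRicci_eventually 0 2 2), pd_chart, vec4_one]
    simp [dRicTable_v, vec4_two]
  have e₂ : pd 2 (fun y => dRicci (gnMetric D K) y 2 2 2) x = 0 := by
    rw [pd_congr (h.dRicci_eventually 2 2 2), pd_chart, vec4_two]
    simp only [funext fun θ => dRicTable_theta (D := D) (K := K) (r := x 1) (θ := θ) 2 2]
    simp [vec4_two]
  simp only [boxRicci, h.trace, ddRicci, e₁, e₂, h.pd_dRicci_v, h.pd_dRicci_phi,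
    Fin.sum_univ_four, h.christoffel, h.dRicci_v, h.dRicci_theta, h.dRicci_phi,
    vec4_zero, vec4_one, vec4_two, vec4_three, Pi.zero_apply]
  simp

end DegeneratePoint

namespace DegeneratePoint

variable {D K : ℝ → ℝ} {x : Pt}

/-! ### The field equations at a degenerate horizon -/

/-- The `rr` component is excluded because it alone retains the Hessian of `P'(R)Φ`. -/
theorem cPoly (h : DegeneratePoint D K x) (P : Polynomial ℝ) (Φ : ℝ → ℝ) (a b : Fin 4)
    (hab : a ≠ 1 ∨ b ≠ 1) :
    cPoly P (gnMetric D K) (radial Φ) x a b =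
      P.derivative.eval (2 * (K (x 1))⁻¹ - deriv (deriv D) (x 1)) * Φ (x 1) *
          HorizonGeometry.ricci (gnMetric D K) x a b
        - 1 / 2 * gnMetric D K x a b *
          P.eval (2 * (K (x 1))⁻¹ - deriv (deriv D) (x 1)) * Φ (x 1) := by
  have e : (fun y => P.derivative.eval (HorizonGeometry.ricciScalar (gnMetric D K) y) *
      radial Φ y) =ᶠ[𝓝 x] radial fun r => P.derivative.eval
        (-2 * ricH D K r + D r * ricQ K r + 2 * ricW D K r / K r) * Φ r := by
    filter_upwards [h.ricciScalar_eventually] with y hy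
    rw [hy]; rfl
  have e' : HorizonGeometry.hess (gnMetric D K) (fun y => P.derivative.eval
      (HorizonGeometry.ricciScalar (gnMetric D K) y) * radial Φ y) x a b = 0 := by
    rw [h.hess e]
    revert a b
    refine forall_fin_four ?_ ?_ ?_ ?_ <;> refine forall_fin_four ?_ ?_ ?_ ?_ <;>
      simp [vec4_zero, vec4_one, vec4_two, vec4_three]
  rw [HorizonGeometry.cPoly, e', h.box e, h.ricciScalar]
  simp only [radial]
  ring

theorem pd_radial_eq (Φ : ℝ → ℝ) (μ : Fin 4) :
    pd μ (radial Φ) x = vec4 0 (deriv Φ (x 1)) 0 0 μ := pd_radial Φ x μ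

theorem hess_radial (h : DegeneratePoint D K x) (Φ : ℝ → ℝ) (a b : Fin 4) :
    HorizonGeometry.hess (gnMetric D K) (radial Φ) x a b =
      vec4 0 (vec4 0 (deriv (deriv Φ) (x 1)) 0 0) 0 0 a b :=
  h.hess Filter.EventuallyEq.rfl a b

theorem box_radial (h : DegeneratePoint D K x) (Φ : ℝ → ℝ) :
    HorizonGeometry.box (gnMetric D K) (radial Φ) x = 0 :=
  h.box Filter.EventuallyEq.rfl

/-- Terms with derivatives of `Φ` or `R` either are `rr` tensors or contract with vanishing
`v`-components; only the multiple of `Φ` itself remains. -/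
theorem cRicci_vr (h : DegeneratePoint D K x) (Φ : ℝ → ℝ) :
    cRicci (gnMetric D K) (radial Φ) x 0 1 =
      Φ (x 1) * (deriv (deriv D) (x 1) ^ 2 / 4 - (K (x 1))⁻¹ ^ 2) := by
  simp only [cRicci, symRicci, advRicci, ricciHess, h.boxRicci_vr, h.riemannContract_vr,
    h.ricciSq, h.box h.ricciScalar_eventually, h.hess h.ricciScalar_eventually, h.box_radial,
    h.gradInner (Filter.EventuallyEq.refl _ (radial Φ)) h.ricciScalar_eventually,
    h.trace, h.inner2, h.hess_radial, h.ricci, h.metric, h.dRicci_v, h.dRicci_r_vv,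
    pd_radial_eq, (pd_eventually h.ricciScalar_eventually _).self_of_nhds, radial,
    vec4_zero, vec4_one, vec4_two, vec4_three, Pi.zero_apply]
  ring

theorem cRicci_thetatheta (h : DegeneratePoint D K x) (Φ : ℝ → ℝ) :
    cRicci (gnMetric D K) (radial Φ) x 2 2 =
      K (x 1) * (Φ (x 1) * ((K (x 1))⁻¹ ^ 2 - deriv (deriv D) (x 1) ^ 2 / 4)) := by
  have hK := h.K_ne
  simp only [cRicci, symRicci, advRicci, ricciHess, h.boxRicci_thetatheta,
    h.riemannContract_thetatheta,
    h.ricciSq, h.box h.ricciScalar_eventually, h.hess h.ricciScalar_eventually, h.box_radial,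
    h.gradInner (Filter.EventuallyEq.refl _ (radial Φ)) h.ricciScalar_eventually,
    h.trace, h.inner2, h.hess_radial, h.ricci, h.metric, h.dRicci_v, h.dRicci_theta,
    pd_radial_eq, (pd_eventually h.ricciScalar_eventually _).self_of_nhds, radial,
    vec4_zero, vec4_one, vec4_two, vec4_three, Pi.zero_apply]
  field_simp
  ring

theorem cRiemann_vr (h : DegeneratePoint D K x) (Φ : ℝ → ℝ) :
    cRiemann (gnMetric D K) (radial Φ) x 0 1 =
      Φ (x 1) * (deriv (deriv D) (x 1) ^ 2 / 2 - 2 * (K (x 1))⁻¹ ^ 2) := by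
  simp only [cRiemann, symRicci, advRicci, h.boxRicci_vr, h.riemannContract_vr,
    h.ricciSq, h.hess h.ricciScalar_eventually, h.ricciScalar,
    h.trace, h.hess_radial, h.ricci, h.metric, h.dRicci_v, h.dRicci_r_vv,
    pd_radial_eq, radial, vec4_zero, vec4_one, vec4_two, vec4_three, Pi.zero_apply]
  ring

theorem cRiemann_thetatheta (h : DegeneratePoint D K x) (Φ : ℝ → ℝ) :
    cRiemann (gnMetric D K) (radial Φ) x 2 2 =
      K (x 1) * (Φ (x 1) * (2 * (K (x 1))⁻¹ ^ 2 - deriv (deriv D) (x 1) ^ 2 / 2)) := by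
  have hK := h.K_ne
  simp only [cRiemann, symRicci, advRicci, h.boxRicci_thetatheta, h.riemannContract_thetatheta,
    h.ricciSq, h.hess h.ricciScalar_eventually, h.ricciScalar,
    h.trace, h.hess_radial, h.ricci, h.metric, h.dRicci_v, h.dRicci_theta,
    pd_radial_eq, radial, vec4_zero, vec4_one, vec4_two, vec4_three, Pi.zero_apply]
  field_simp
  ring

theorem stressScalar (h : DegeneratePoint D K x) (Φ : ℝ → ℝ) (a b : Fin 4)
    (hab : a ≠ 1 ∨ b ≠ 1) : stressScalar (gnMetric D K) (radial Φ) x a b = 0 := by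
  rw [HorizonGeometry.stressScalar, h.gradInner Filter.EventuallyEq.rfl
    Filter.EventuallyEq.rfl, pd_radial_eq, pd_radial_eq]
  revert a b
  refine forall_fin_four ?_ ?_ ?_ ?_ <;> refine forall_fin_four ?_ ?_ ?_ ?_ <;>
    simp [vec4_zero, vec4_one, vec4_two, vec4_three]

/-- The `vr` component of the gravitational equations, with `a = D''/2`, `b = 1/K`. -/
theorem gravity_vr (h : DegeneratePoint D K x) {ε : ℝ} {P : Polynomial ℝ} {α₂ α₃ : ℝ}
    {Φ : ℝ → ℝ} {a b : ℝ} (ha : a = deriv (deriv D) (x 1) / 2) (hb : b = (K (x 1))⁻¹)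
    (e : einstein (gnMetric D K) x 0 1
      + 16 * Real.pi * ε * cTensor P α₂ α₃ (gnMetric D K) (radial Φ) x 0 1
      - 8 * Real.pi * HorizonGeometry.stressScalar (gnMetric D K) (radial Φ) x 0 1 = 0) :
    -b + 16 * Real.pi * ε * Φ (x 1) * (-(P.derivative.eval (2 * (b - a)) * a)
      - P.eval (2 * (b - a)) / 2 + (α₂ + 2 * α₃) * (a ^ 2 - b ^ 2)) = 0 := by
  have hR : 2 * (K (x 1))⁻¹ - deriv (deriv D) (x 1) = 2 * (b - a) := by rw [ha, hb]; ring
  rw [cTensor, h.cPoly P Φ 0 1 (by simp), h.cRicci_vr, h.cRiemann_vr,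
    h.stressScalar Φ 0 1 (by simp), einstein, h.ricciScalar, hR, h.ricci, h.metric] at e
  simp only [vec4_zero, vec4_one] at e
  have hA : deriv (deriv D) (x 1) = 2 * a := by rw [ha]; ring
  rw [hA, ← hb] at e
  linear_combination e

/-- The `θθ` component of the gravitational equations, with `a = D''/2`, `b = 1/K`. -/
theorem gravity_thetatheta (h : DegeneratePoint D K x) {ε : ℝ} {P : Polynomial ℝ} {α₂ α₃ : ℝ}
    {Φ : ℝ → ℝ} {a b : ℝ} (ha : a = deriv (deriv D) (x 1) / 2) (hb : b = (K (x 1))⁻¹)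
    (e : einstein (gnMetric D K) x 2 2
      + 16 * Real.pi * ε * cTensor P α₂ α₃ (gnMetric D K) (radial Φ) x 2 2
      - 8 * Real.pi * HorizonGeometry.stressScalar (gnMetric D K) (radial Φ) x 2 2 = 0) :
    a + 16 * Real.pi * ε * Φ (x 1) * (P.derivative.eval (2 * (b - a)) * b
      - P.eval (2 * (b - a)) / 2 + (α₂ + 2 * α₃) * (b ^ 2 - a ^ 2)) = 0 := by
  have hR : 2 * (K (x 1))⁻¹ - deriv (deriv D) (x 1) = 2 * (b - a) := by rw [ha, hb]; ring
  rw [cTensor, h.cPoly P Φ 2 2 (by simp), h.cRicci_thetatheta, h.cRiemann_thetatheta,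
    h.stressScalar Φ 2 2 (by simp), einstein, h.ricciScalar, hR, h.ricci, h.metric] at e
  simp only [vec4_two] at e
  have hA : deriv (deriv D) (x 1) = 2 * a := by rw [ha]; ring
  have hbK : b * K (x 1) = 1 := by rw [hb, inv_mul_cancel₀ h.K_ne]
  rw [hA, ← hb] at e
  generalize P.derivative.eval (2 * (b - a)) = p' at *
  generalize P.eval (2 * (b - a)) = p at *
  -- Multiplying by `b = 1/K` normalises the `θθ` equation; the multiple of `hbK` replaces `b * K`
  -- by `1` in the terms proportional to `g_{θθ}`.
  linear_combination b * e + (b - a - 16 * Real.pi * ε * Φ (x 1) *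
    (-p / 2 + (α₂ + 2 * α₃) * (b ^ 2 - a ^ 2))) * hbK

theorem scalar_equation (h : DegeneratePoint D K x) {ε : ℝ} {P : Polynomial ℝ} {α₂ α₃ : ℝ}
    {Φ : ℝ → ℝ} {a b : ℝ} (ha : a = deriv (deriv D) (x 1) / 2) (hb : b = (K (x 1))⁻¹)
    (e : HorizonGeometry.box (gnMetric D K) (radial Φ) x
      + ε * curvScalar P α₂ α₃ (gnMetric D K) x = 0) :
    ε * (P.eval (2 * (b - a)) + 2 * (α₂ + 2 * α₃) * (a ^ 2 + b ^ 2)) = 0 := by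
  have hR : 2 * (K (x 1))⁻¹ - deriv (deriv D) (x 1) = 2 * (b - a) := by rw [ha, hb]; ring
  have hA : deriv (deriv D) (x 1) = 2 * a := by rw [ha]; ring
  rw [h.box_radial, curvScalar, h.ricciScalar, h.ricciSq, h.riemannSq, hR, hA, ← hb] at e
  linear_combination e

end DegeneratePoint

/-! ### Static black holes -/

namespace IsStaticBlackHole

variable {δ p : ℝ} {D D₀ K : ℝ → ℝ}

theorem zero_mem (h : IsStaticBlackHole δ p D D₀ K) : (0 : ℝ) ∈ Set.Ioo (-δ) δ :=
  ⟨by linarith [h.delta_pos], h.delta_pos⟩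

theorem D_zero (h : IsStaticBlackHole δ p D D₀ K) : D 0 = 0 := by
  rw [h.D_eq 0 ⟨le_rfl, h.delta_pos⟩, Real.zero_rpow (by linarith [h.p_nonneg]), zero_mul]

theorem K_zero_pos (h : IsStaticBlackHole δ p D D₀ K) : 0 < K 0 :=
  h.K_pos 0 ⟨le_rfl, h.delta_pos⟩

/-- For `r > 0` the slope of `D` from `0` is `r^p * D₀ r`; its right limit is the derivative. The
convention `0^0 = 1` covers `p = 0` as well. -/
theorem deriv_D_zero (h : IsStaticBlackHole δ p D D₀ K) : deriv D 0 = 0 ^ p * D₀ 0 := by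
  have hn : Set.Ioo (-δ) δ ∈ 𝓝 (0 : ℝ) := isOpen_Ioo.mem_nhds h.zero_mem
  have hD : HasDerivAt D (deriv D 0) 0 :=
    ((h.smooth_D.contDiffAt hn).differentiableAt (by simp)).hasDerivAt
  have hD₀ : ContinuousAt D₀ 0 := (h.smooth_D₀.contDiffAt hn).continuousAt
  have h₁ : Filter.Tendsto (slope D 0) (𝓝[>] 0) (𝓝 (deriv D 0)) :=
    (hasDerivAt_iff_tendsto_slope.1 hD).mono_left
      (nhdsWithin_mono _ fun r (hr : 0 < r) => hr.ne')
  have h₂ : Filter.Tendsto (fun r => r ^ p * D₀ r) (𝓝[>] 0) (𝓝 (0 ^ p * D₀ 0)) :=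
    ((Real.continuousAt_rpow_const 0 p (Or.inr h.p_nonneg)).mul hD₀).tendsto.mono_left
      nhdsWithin_le_nhds
  refine tendsto_nhds_unique h₁ (h₂.congr' ?_)
  filter_upwards [Ioo_mem_nhdsGT h.delta_pos] with r hr
  rw [slope_def_field, h.D_zero, h.D_eq r ⟨hr.1.le, hr.2⟩, Real.rpow_add hr.1, Real.rpow_one,
    sub_zero, sub_zero]
  field_simp [hr.1.ne']

theorem deriv_D_zero_ne (h : IsStaticBlackHole δ p D D₀ K) (hp : p = 0) : deriv D 0 ≠ 0 := by
  rw [h.deriv_D_zero, hp, Real.rpow_zero, one_mul]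
  exact h.D₀_ne

theorem deriv_D_zero_eq (h : IsStaticBlackHole δ p D D₀ K) (hp : p ≠ 0) : deriv D 0 = 0 := by
  rw [h.deriv_D_zero, Real.zero_rpow hp, zero_mul]

/-- The surface gravity is `D'(0) / 2`. -/
theorem nonExtremal (h : IsStaticBlackHole δ p D D₀ K) (hp : p = 0) : NonExtremal D K := by
  refine ⟨deriv D 0 / 2, div_ne_zero (h.deriv_D_zero_ne hp) two_ne_zero, ?_⟩
  rintro x ⟨hx, hs⟩ a
  have hK : K (x 1) ≠ 0 := by rw [hx]; exact h.K_zero_pos.ne'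
  rw [christoffel_gnMetric hK hs, hx]
  revert a
  refine forall_fin_four ?_ ?_ ?_ ?_ <;>
    simp [chrR, chrT, vec4_zero, vec4_one, vec4_two, vec4_three, h.D_zero]

theorem contDiffOn_derivs (h : IsStaticBlackHole δ p D D₀ K) :
    ContDiffOn ℝ ∞ (deriv D) (Set.Ioo (-δ) δ) ∧
      ContDiffOn ℝ ∞ (deriv (deriv D)) (Set.Ioo (-δ) δ) ∧
      ContDiffOn ℝ ∞ (deriv K) (Set.Ioo (-δ) δ) ∧
      ContDiffOn ℝ ∞ (deriv (deriv K)) (Set.Ioo (-δ) δ) := by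
  have hD := h.smooth_D.deriv_of_isOpen (m := ∞) isOpen_Ioo le_rfl
  have hK := h.smooth_K.deriv_of_isOpen (m := ∞) isOpen_Ioo le_rfl
  exact ⟨hD, hD.deriv_of_isOpen isOpen_Ioo le_rfl, hK, hK.deriv_of_isOpen isOpen_Ioo le_rfl⟩

theorem eventually_regularRadius (h : IsStaticBlackHole δ p D D₀ K) :
    ∀ᶠ r in 𝓝 0, RegularRadius D K r := by
  obtain ⟨hD', -, hK', -⟩ := h.contDiffOn_derivs
  have hn : Set.Ioo (-δ) δ ∈ 𝓝 (0 : ℝ) := isOpen_Ioo.mem_nhds h.zero_mem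
  have hK : ContinuousAt K 0 := (h.smooth_K.contDiffAt hn).continuousAt
  filter_upwards [hn, hK.eventually_ne h.K_zero_pos.ne'] with r hr hKr
  have hr := isOpen_Ioo.mem_nhds hr
  exact ⟨(h.smooth_D.contDiffAt hr).differentiableAt (by simp),
    (hD'.contDiffAt hr).differentiableAt (by simp),
    (h.smooth_K.contDiffAt hr).differentiableAt (by simp),
    (hK'.contDiffAt hr).differentiableAt (by simp), hKr⟩

theorem eventually_regular (h : IsStaticBlackHole δ p D D₀ K) {x : Pt} (hx : x ∈ horizon) :
    ∀ᶠ y in 𝓝 x, RegularRadius D K (y 1) ∧ Real.sin (y 2) ≠ 0 := by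
  have h₁ : Filter.Tendsto (fun y : Pt => y 1) (𝓝 x) (𝓝 0) := by
    rw [← hx.1]; exact (continuous_apply 1).tendsto x
  have h₂ : ContinuousAt (fun y : Pt => Real.sin (y 2)) x :=
    (Real.continuous_sin.comp (continuous_apply 2)).continuousAt
  exact (h₁.eventually h.eventually_regularRadius).and (h₂.eventually_ne hx.2)

/-- A point on the equator of the horizon. -/
def equator : Pt := vec4 0 0 (Real.pi / 2) 0

theorem equator_mem_horizon : equator ∈ horizon := by
  refine ⟨rfl, ?_⟩
  change Real.sin (Real.pi / 2) ≠ 0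
  simp

theorem horizon_subset_domain (h : IsStaticBlackHole δ p D D₀ K) : horizon ⊆ domain δ :=
  fun _ hx => ⟨hx.1.ge, hx.1.trans_lt h.delta_pos, hx.2⟩

theorem degeneratePoint (h : IsStaticBlackHole δ p D D₀ K) (hp : p ≠ 0) :
    DegeneratePoint D K equator := by
  have hn : Set.Ioo (-δ) δ ∈ 𝓝 (0 : ℝ) := isOpen_Ioo.mem_nhds h.zero_mem
  obtain ⟨hD', hD'', hK', hK''⟩ := h.contDiffOn_derivs
  have hd : ∀ {f : ℝ → ℝ}, ContDiffOn ℝ ∞ f (Set.Ioo (-δ) δ) → DifferentiableAt ℝ f 0 :=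
    fun hf => (hf.contDiffAt hn).differentiableAt (by simp)
  have hK0 : K 0 ≠ 0 := h.K_zero_pos.ne'
  refine ⟨h.eventually_regular equator_mem_horizon, h.D_zero, h.deriv_D_zero_eq hp,
    Real.sin_pi_div_two, Real.cos_pi_div_two, ?_, ?_⟩
  · change DifferentiableAt ℝ (fun r => _) 0
    exact ((hd hD'').fun_add (((hd hD').fun_mul (hd hK')).fun_div (hd h.smooth_K) hK0)).div_const 2
  · change DifferentiableAt ℝ (fun r => _) 0
    exact (((hd hK'').fun_div (hd h.smooth_K) hK0).fun_neg).fun_add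
      (((hd hK').fun_pow 2).fun_div (((hd h.smooth_K).fun_pow 2).const_mul 2) (by simpa using hK0))

/-- Were `D''(0) < 0`, the critical point `0` would be a local maximum with value `0`, against `D >
0` outside. This gives `a ≥ 0`, hence `a + b > 0`. -/
theorem deriv_deriv_D_nonneg (h : IsStaticBlackHole δ p D D₀ K) (hp : p ≠ 0) :
    0 ≤ deriv (deriv D) 0 := by
  by_contra! hneg
  have hn : Set.Ioo (-δ) δ ∈ 𝓝 (0 : ℝ) := isOpen_Ioo.mem_nhds h.zero_mem
  have hmax : ∀ᶠ r in 𝓝 0, D r ≤ D 0 := isLocalMax_of_deriv_deriv_neg hneg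
    (h.deriv_D_zero_eq hp) (h.smooth_D.contDiffAt hn).continuousAt
  have : ∀ᶠ r in 𝓝[>] (0 : ℝ), False := by
    filter_upwards [hmax.filter_mono nhdsWithin_le_nhds, Ioo_mem_nhdsGT h.delta_pos] with r h₁ h₂
    linarith [h.D_pos r h₂, h.D_zero]
  simpa using this.exists

/-- Holds for every `p`: `g^{rr} = D` removes `Φ''` at the horizon. -/
theorem box_radial (h : IsStaticBlackHole δ p D D₀ K) (Φ : ℝ → ℝ) {x : Pt} (hx : x ∈ horizon) :
    box (gnMetric D K) (radial Φ) x = deriv D 0 * deriv Φ 0 := by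
  have h0 := (h.eventually_regular hx).self_of_nhds
  have e : ∀ a b, pd a (pd b (radial Φ)) x = pd a (fun y => vec4 0 (deriv Φ (y 1)) 0 0 b) x :=
    fun a b => pd_congr (.of_forall fun y => pd_radial Φ y b) a
  have e' : ∀ a, pd a (radial Φ) x = vec4 0 (deriv Φ (x 1)) 0 0 a := pd_radial Φ x
  simp only [box, trace, hess, e, e', christoffel_gnMetric h0.1.K_ne h0.2,
    ginv_gnMetric h0.1.K_ne h0.2, Fin.sum_univ_four, vec4_zero, vec4_one, vec4_two, vec4_three,
    chrR, chrT, hx.1, h.D_zero, pd_const, pd_radial (deriv Φ)]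
  simp
  ring

end IsStaticBlackHole

/-! ### Algebra of the extremal horizon equations -/

/-- The field equations at an extremal horizon, in terms of the curvatures `-a` and `b` of the
near-horizon geometry. -/
theorem IsRegularSolution.degenerate_equations {ε : ℝ} {P : Polynomial ℝ} {α₂ α₃ δ p : ℝ}
    {D D₀ K Φ : ℝ → ℝ} (h : IsRegularSolution ε P α₂ α₃ δ p D D₀ K Φ) (hp : p ≠ 0) :
    ∃ a b : ℝ, 0 ≤ a ∧ 0 < b ∧
      (∀ x ∈ horizon, ricciScalar (gnMetric D K) x = 2 * (b - a)) ∧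
      -b + 16 * Real.pi * ε * Φ 0 * (-(P.derivative.eval (2 * (b - a)) * a)
        - P.eval (2 * (b - a)) / 2 + (α₂ + 2 * α₃) * (a ^ 2 - b ^ 2)) = 0 ∧
      a + 16 * Real.pi * ε * Φ 0 * (P.derivative.eval (2 * (b - a)) * b
        - P.eval (2 * (b - a)) / 2 + (α₂ + 2 * α₃) * (b ^ 2 - a ^ 2)) = 0 ∧
      ε * (P.eval (2 * (b - a)) + 2 * (α₂ + 2 * α₃) * (a ^ 2 + b ^ 2)) = 0 := by
  have hbh := h.blackHole
  have hd := hbh.degeneratePoint hp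
  have hx := hbh.horizon_subset_domain IsStaticBlackHole.equator_mem_horizon
  refine ⟨deriv (deriv D) 0 / 2, (K 0)⁻¹, by linarith [hbh.deriv_deriv_D_nonneg hp],
    inv_pos.2 hbh.K_zero_pos, fun x hx => ?_, hd.gravity_vr rfl rfl (h.gravity _ hx 0 1),
    hd.gravity_thetatheta rfl rfl (h.gravity _ hx 2 2), hd.scalar_equation rfl rfl (h.scalar _ hx)⟩
  rw [ricciScalar_gnMetric (hbh.eventually_regular hx), ricH, ricW, hx.1, hbh.D_zero,
    hbh.deriv_D_zero_eq hp]
  ring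

/-- Modified quadratic gravity has no extremal solutions. -/
theorem IsRegularSolution.exponent_eq_zero_of_quadratic {α₁ ε α₂ α₃ δ p : ℝ} {D D₀ K Φ : ℝ → ℝ}
    (h : IsRegularSolution ε (Polynomial.C α₁ * Polynomial.X ^ 2) α₂ α₃ δ p D D₀ K Φ) :
    p = 0 := by
  by_contra hp
  obtain ⟨a, b, -, hb, -, e₁, e₂, e₃⟩ := h.degenerate_equations hp
  have hP : (Polynomial.C α₁ * Polynomial.X ^ 2).eval (2 * (b - a)) = 4 * α₁ * (b - a) ^ 2 := by
    simp; ring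
  have hP' : (Polynomial.C α₁ * Polynomial.X ^ 2).derivative.eval (2 * (b - a)) =
      4 * α₁ * (b - a) := by
    simp; ring
  rw [hP] at e₁ e₂ e₃
  rw [hP'] at e₁ e₂
  -- `P` is homogeneous of degree two, so `P = (b - a) * P'` at `R = 2(b - a)`, and the coupling
  -- terms cancel in the sum.
  have hab : a = b := by linear_combination e₁ + e₂
  subst hab
  have : a = 0 := by linear_combination -e₁
  exact hb.ne' this

/-- At an extremal horizon of an `𝓕(R)` theory the effective gravitational coupling vanishes. -/
theorem IsRegularSolution.coupling_eq_zero {ε : ℝ} {P : Polynomial ℝ} {α₂ α₃ δ p : ℝ}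
    {D D₀ K Φ : ℝ → ℝ} (h : IsRegularSolution ε P α₂ α₃ δ p D D₀ K Φ) (hp : p ≠ 0)
    (hP : (α₂ = 0 ∧ α₃ = 0) ∨ ∃ α₁ : ℝ, P = Polynomial.C α₁ * Polynomial.X) :
    (∀ x ∈ horizon,
      1 + 16 * Real.pi * ε * P.derivative.eval (ricciScalar (gnMetric D K) x) * Φ 0 = 0) ∧
      1 + 16 * Real.pi * ε * P.derivative.eval 0 * Φ 0 = 0 := by
  obtain ⟨a, b, ha, hb, hR, e₁, e₂, e₃⟩ := h.degenerate_equations hp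
  have hab : a + b ≠ 0 := by positivity
  -- The second conjunct exchanges `P'(R)`, which may vary with the solution, for the fixed number
  -- `P'(0)`.
  suffices hs : 1 + 16 * Real.pi * ε * P.derivative.eval (2 * (b - a)) * Φ 0 = 0 ∧
      P.derivative.eval 0 = P.derivative.eval (2 * (b - a)) by
    refine ⟨fun x hx => ?_, ?_⟩
    · rw [hR x hx, hs.1]
    · rw [hs.2, hs.1]
  rcases hP with ⟨rfl, rfl⟩ | ⟨α₁, rfl⟩
  · have hs : 1 + 16 * Real.pi * ε * P.derivative.eval (2 * (b - a)) * Φ 0 = 0 := by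
      refine (mul_eq_zero.1 ?_).resolve_left hab
      linear_combination e₂ - e₁
    -- Using `16πεP'Φ = -1`, the `vr` equation becomes `a - b = 8πεPΦ`, and the scalar equation
    -- gives `εP = 0`; hence `R = 0`.
    have hba : b - a = 0 := by
      linear_combination -a * hs - e₁ - 8 * Real.pi * Φ 0 * e₃
    exact ⟨hs, by rw [hba, mul_zero]⟩
  · have hev : ∀ R, (Polynomial.C α₁ * Polynomial.X).derivative.eval R = α₁ := by simp
    have hev' : (Polynomial.C α₁ * Polynomial.X).eval (2 * (b - a)) = 2 * α₁ * (b - a) := by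
      simp; ring
    simp only [hev, hev'] at *
    refine ⟨?_, trivial⟩
    by_contra hs
    -- For linear `P` the sum of the equations is `(a - b)(1 + 16πεα₁Φ) = 0`. If the second factor
    -- is nonzero then `a = b`, and the difference of the equations makes it vanish after all.
    have hba : a = b := by
      have : (a - b) * (1 + 16 * Real.pi * ε * α₁ * Φ 0) = 0 := by
        linear_combination e₁ + e₂
      linarith [(mul_eq_zero.1 this).resolve_right hs]
    subst hba
    apply hs
    refine (mul_eq_zero.1 ?_).resolve_left hab
    linear_combination e₂ - e₁

end HorizonGeometry

end

theorem mainTheorem3 :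
    -- an arbitrary curvature scalar (and arbitrary matter), not zero at the horizon
    (∀ (δ p ε : ℝ) (D D₀ K Φ : ℝ → ℝ)
        (𝓕 : HorizonGeometry.MetricField → HorizonGeometry.Pt → ℝ),
      ε ≠ 0 →
      HorizonGeometry.IsStaticBlackHole δ p D D₀ K →
      HorizonGeometry.RegularAtHorizon δ Φ →
      HorizonGeometry.ScalarEquation δ ε 𝓕 D K Φ →
      (∃ x ∈ HorizonGeometry.horizon, 𝓕 (HorizonGeometry.gnMetric D K) x ≠ 0) →
      p = 0 ∧ HorizonGeometry.NonExtremal D K) ∧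
    -- modified quadratic gravity, whether or not the curvature scalar vanishes at the horizon
    (∀ (α₁ α₂ α₃ ε δ p : ℝ) (D D₀ K Φ : ℝ → ℝ),
      HorizonGeometry.IsRegularSolution ε
        (Polynomial.C α₁ * Polynomial.X ^ 2) α₂ α₃ δ p D D₀ K Φ →
      p = 0 ∧ HorizonGeometry.NonExtremal D K) ∧
    -- polynomial functions of the Ricci scalar, or `α₁ R + α₂ Ric² + α₃ Riem²`
    (∀ (P : Polynomial ℝ) (α₂ α₃ : ℝ),
      ((α₂ = 0 ∧ α₃ = 0) ∨ ∃ α₁ : ℝ, P = Polynomial.C α₁ * Polynomial.X) →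
      -- families of solutions that are regular in the coupling constant as it tends to zero
      (∀ (S : Set ℝ) (δ p : ℝ → ℝ) (D D₀ K Φ : ℝ → ℝ → ℝ),
        (0 : ℝ) ∈ closure S →
        (∀ ε ∈ S, HorizonGeometry.IsRegularSolution ε P α₂ α₃
          (δ ε) (p ε) (D ε) (D₀ ε) (K ε) (Φ ε)) →
        HorizonGeometry.RegularInCoupling S D →
        HorizonGeometry.RegularInCoupling S K →
        HorizonGeometry.RegularInCoupling S Φ →
        (∀ᶠ ε in nhdsWithin 0 S, p ε = 0 ∧ HorizonGeometry.NonExtremal (D ε) (K ε)) ∧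
        ((∃ p₀ : ℝ, ∀ ε ∈ S, p ε = p₀) →
          ∀ ε ∈ S, p ε = 0 ∧ HorizonGeometry.NonExtremal (D ε) (K ε))) ∧
      -- a single solution, at any value of the coupling constant
      (∀ (ε δ p : ℝ) (D D₀ K Φ : ℝ → ℝ),
        HorizonGeometry.IsRegularSolution ε P α₂ α₃ δ p D D₀ K Φ →
        (∃ x ∈ HorizonGeometry.horizon,
          1 + 16 * Real.pi * ε *
            P.derivative.eval
              (HorizonGeometry.ricciScalar (HorizonGeometry.gnMetric D K) x) * Φ 0 ≠ 0) →
        p = 0 ∧ HorizonGeometry.NonExtremal D K)) := by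
  refine ⟨?_, ?_, ?_⟩
  · rintro δ p ε D D₀ K Φ 𝓕 hε hbh - hs ⟨x, hx, h𝓕⟩
    have hp : p = 0 := by
      by_contra hp
      have e := hs x (hbh.horizon_subset_domain hx)
      rw [hbh.box_radial Φ hx, hbh.deriv_D_zero_eq hp, zero_mul, zero_add] at e
      exact mul_ne_zero hε h𝓕 e
    exact ⟨hp, hbh.nonExtremal hp⟩
  · intro α₁ α₂ α₃ ε δ p D D₀ K Φ h
    have hp := h.exponent_eq_zero_of_quadratic
    exact ⟨hp, h.blackHole.nonExtremal hp⟩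
  · intro P α₂ α₃ hP
    refine ⟨?_, ?_⟩
    · rintro S δ p D D₀ K Φ hS h - - hΦ
      have hev : ∀ᶠ ε in 𝓝[S] 0, p ε = 0 := by
        -- Convergence of the horizon value `Φ ε 0` makes `1 + 16πεP'(0)Φ` tend to `1`, so it is
        -- eventually nonzero.
        obtain ⟨l, hl⟩ := hΦ 0
        simp only [iteratedDeriv_zero] at hl
        have ht : Filter.Tendsto
            (fun ε => 1 + 16 * Real.pi * ε * P.derivative.eval 0 * Φ ε 0) (𝓝[S] 0)
            (𝓝 (1 + 16 * Real.pi * 0 * P.derivative.eval 0 * l)) := by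
          have hid : Filter.Tendsto (fun ε : ℝ => ε) (𝓝[S] 0) (𝓝 0) := nhdsWithin_le_nhds
          exact ((((hid.const_mul _).mul_const _).mul hl).const_add 1)
        filter_upwards [ht.eventually (isOpen_ne.mem_nhds (by simp : _ ≠ (0 : ℝ))), self_mem_nhdsWithin] with ε hε hεS
        by_contra hp
        exact hε ((h ε hεS).coupling_eq_zero hp hP).2
      refine ⟨?_, ?_⟩
      · filter_upwards [hev, self_mem_nhdsWithin] with ε hp hεS
        exact ⟨hp, (h ε hεS).blackHole.nonExtremal hp⟩
      · rintro ⟨p₀, hp₀⟩ ε hεS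
        -- As `0` lies in the closure of `S`, some `ε' ∈ S` has exponent `0`, and the common
        -- exponent carries this over to all of `S`.
        have := mem_closure_iff_nhdsWithin_neBot.1 hS
        obtain ⟨ε', hp', hε'⟩ := (hev.and self_mem_nhdsWithin).exists
        have hp : p ε = 0 := by rw [hp₀ ε hεS, ← hp₀ ε' hε', hp']
        exact ⟨hp, (h ε hεS).blackHole.nonExtremal hp⟩
    · rintro ε δ p D D₀ K Φ h ⟨x, hx, hne⟩
      have hp : p = 0 := by
        by_contra hp
        exact hne ((h.coupling_eq_zero hp hP).1 x hx)
      exact ⟨hp, h.blackHole.nonExtremal hp⟩
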